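/- Consider a rating system with a finite set $S$ of sellers and a finite set of $N$ buyers. For each seller $i$ let $B_i$ be the set of buyers who have already interacted with $i$, where $\sum_{i\in S}|B_i|\le N$; some of the buyers in $B_i$ have rated $i$ with a value in $[0,1]$, and $\bar r_i$ denotes the average of these ratings ($\bar r_i=0$ if there are none). Let $k\ge 0$ be the profit from one purchase and $\mathcal N=N-\sum_{i}|B_i|$ the number of potential buyers. In the bribery game $G$ every seller $i$ chooses a number $\phi_i\in\{0,1,\dots,\mathcal N\}$ of new buyers to bribe, at cost $1$ each, who then give rating $1$ and are no longer potential buyers. The payoff of seller $i$ is $$\pi_i(\phi)=u_i(\phi)-u_i^0-\phi_i,\qquad u_i(\phi)=k\Bigl(\mathcal N-\sum_{j\in S}\phi_j\Bigr)\frac{\bar r_i|B_i|+\phi_i}{|B_i|+\phi_i},\qquad u_i^0=k\,\mathcal N\,\bar r_i ,$$ where the quotient is read as $0$ if $|B_i|=\phi_i=0$. A (pure-strategy) Nash equilibrium is a profile $\phi=(\phi_i)_{i\in S}$ in which no seller can increase its payoff by changing its own strategy alone. Consider the constraints $$\phi_i\in\mathbb N,\qquad \sum_{i\in S}\phi_i\le\mathcal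 N,\qquad \phi_i=0\ \text{ if }\ |B_i|\ge k\,\mathcal N. \tag{C}$$ Theorem. 1. The bribery game $G$ has at least one Nash equilibrium (in pure strategies). 2. A profile $\phi\in\mathbb N^S$ is a Nash equilibrium if and only if it satisfies (C) and, for every seller $i$, the first-order condition in integers $$u_i(\phi_i+1,\phi_{-i})-u_i(\phi_i,\phi_{-i})\le 1,\qquad\text{and, if }\phi_i>0,\quad 1\le u_i(\phi_i,\phi_{-i})-u_i(\phi_i-1,\phi_{-i}).$$ 3. If $\phi$ is a Nash equilibrium and $B_i\ne\emptyset$, then up to rounding $\phi_i$ solves $\partial u_i/\partial\phi_i=1$ or is at the corner: either there is a real $x\ge 0$ with $|x-\phi_i|<1$ and $\frac{\partial u_i}{\partial\phi_i}(x,\phi_{-i})=1$, or $\phi_i=0$ and $\frac{\partial u_i}{\partial\phi_i}(0,\phi_{-i})\le 1$. 4. Conversely, if $\phi\in\mathbb N^S$ satisfies (C) and $\frac{\partial u_i}{\partial\phi_i}(\phi_i,\phi_{-i})=1$ for every seller $i$ with $|B_i|<k\,\mathcal N$, then $\phi$ is a Nash equilibrium. -/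

import Mathlib

/-- The data of a rating system in a fixed time slot, with set of sellers `S` and set of buyers
`B`. Each seller `i` sells one app. -/
structure RatingSystem (S B : Type*) [Fintype S] [Fintype B] where
  /-- `interacted i` is the set `B_i` of buyers who have already interacted with seller `i`. -/
  interacted : S → Finset B
  /-- The members of `B_i` who have submitted a rating (not every buyer rates). -/
  raters : S → Finset B
  raters_subset : ∀ i, raters i ⊆ interacted i
  /-- `rating i b` is the rating of seller `i` by buyer `b`; it is used for `b ∈ raters i` only. -/
  rating : S → B → ℝ
  rating_mem : ∀ i, ∀ b ∈ raters i, rating i b ∈ Set.Icc (0 : ℝ) 1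
  /-- The number `N - ∑ i, |B_i|` of potential buyers is not negative. -/
  sum_card_le : ∑ i, (interacted i).card ≤ Fintype.card B
  /-- The profit `k` from one app purchase. -/
  profit : ℝ
  profit_nonneg : 0 ≤ profit

namespace RatingSystem

variable {S B : Type*} [Fintype S] [Fintype B] (G : RatingSystem S B)

/-- The number `𝒩 = N - ∑ i, |B_i|` of potential buyers (no truncation, by `sum_card_le`). -/
def potentialBuyers : ℕ :=
  Fintype.card B - ∑ i, (G.interacted i).card

/-- The aggregated rating `r̄_i`: the average of the ratings received by seller `i`. For a seller
without any rating this is `0`. -/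
noncomputable def avgRating (i : S) : ℝ :=
  (∑ b ∈ G.raters i, G.rating i b) / ((G.raters i).card : ℝ)

/-- The utility `n * r * k` of a seller with aggregated rating `r` when there are `n` potential
buyers in the market. -/
def expectedUtility (n r : ℝ) : ℝ :=
  n * r * G.profit

/-- The aggregated rating of seller `i` after `x` new buyers have been bribed to give rating `1`:
`(r̄_i * |B_i| + x) / (|B_i| + x)`. For `|B_i| = 0` and `x = 0` this is `0`. -/
noncomputable def bribedRating (i : S) (x : ℝ) : ℝ :=
  (G.avgRating i * ((G.interacted i).card : ℝ) + x) / (((G.interacted i).card : ℝ) + x)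

/-- The initial utility `u⁰` of seller `i`. -/
noncomputable def initialUtility (i : S) : ℝ :=
  G.expectedUtility (G.potentialBuyers : ℝ) (G.avgRating i)

/-- The utility of seller `i` after every seller `j` has bribed `φ j` new buyers, who then no
longer are potential buyers. It is a function of real variables, so that it has partial
derivatives; strategies are natural numbers. -/
noncomputable def utility (i : S) (φ : S → ℝ) : ℝ :=
  G.expectedUtility ((G.potentialBuyers : ℝ) - ∑ j, φ j) (G.bribedRating i (φ i))

/-- The payoff of seller `i`: the gain in utility minus the cost of bribing `φ i` buyers. -/
noncomputable def payoff (i : S) (φ : S → ℝ) : ℝ :=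
  G.utility i φ - G.initialUtility i - φ i

/-- The finite strategy space of every seller: the number of buyers to bribe, out of the `𝒩`
potential buyers. -/
def strategySpace : Finset ℕ :=
  Finset.range (G.potentialBuyers + 1)

/-- A strategy profile in natural numbers, seen as a real vector. -/
def toReal (φ : S → ℕ) : S → ℝ :=
  fun j => (φ j : ℝ)

/-- `φ` is a (pure-strategy) Nash equilibrium of the bribery game: a profile of strategies such
that no seller gains by a unilateral change to another strategy. -/
def IsNashEquilibrium [DecidableEq S] (φ : S → ℕ) : Prop :=
  (∀ i, φ i ∈ G.strategySpace) ∧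
    ∀ i, ∀ x ∈ G.strategySpace,
      G.payoff i (Function.update (toReal φ) i (x : ℝ)) ≤ G.payoff i (toReal φ)

/-- Seller `i` has `|B_i| / 𝒩 ≥ k`. The quotient is multiplied out, so that this also makes sense
(and holds) if `𝒩 = 0`. -/
def IsSaturated (i : S) : Prop :=
  G.profit * (G.potentialBuyers : ℝ) ≤ ((G.interacted i).card : ℝ)

/-- The constraints on a profile of natural numbers: `∑ i, φ i ≤ 𝒩`, and `φ i = 0` if
`|B_i| / 𝒩 ≥ k`. -/
def SatisfiesConstraints (φ : S → ℕ) : Prop :=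
  ∑ i, φ i ≤ G.potentialBuyers ∧ ∀ i, G.IsSaturated i → φ i = 0

/-- The partial derivative `∂u_i / ∂φ_i` exists at the point where `φ_i = x` and all other
coordinates are those of `φ`, and it is equal to `d`. -/
def HasMarginalUtility [DecidableEq S] (i : S) (φ : S → ℕ) (x d : ℝ) : Prop :=
  HasDerivAt (fun y : ℝ => G.utility i (Function.update (toReal φ) i y)) d x

/-- The first-order condition `∂u_i / ∂φ_i = 1` in integers: the next bribed buyer adds at most
the cost `1` to the utility of seller `i`, and the last bribed buyer, if there is one, has added
at least `1`. -/
def IntegerFirstOrderCondition [DecidableEq S] (i : S) (φ : S → ℕ) : Prop :=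
  G.utility i (Function.update (toReal φ) i ((φ i : ℝ) + 1)) - G.utility i (toReal φ) ≤ 1 ∧
    (0 < φ i →
      1 ≤ G.utility i (toReal φ) - G.utility i (Function.update (toReal φ) i ((φ i : ℝ) - 1)))

end RatingSystem

namespace RatingSystem

variable {S B : Type*} [Fintype S] [Fintype B] (G : RatingSystem S B)

theorem avgRating_nonneg (i : S) : 0 ≤ G.avgRating i :=
  div_nonneg (Finset.sum_nonneg fun b hb => (G.rating_mem i b hb).1) (Nat.cast_nonneg _)

theorem avgRating_le_one (i : S) : G.avgRating i ≤ 1 := by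
  refine div_le_one_of_le₀ ?_ (Nat.cast_nonneg _)
  calc ∑ b ∈ G.raters i, G.rating i b ≤ ∑ _b ∈ G.raters i, (1 : ℝ) :=
        Finset.sum_le_sum fun b hb => (G.rating_mem i b hb).2
    _ = ((G.raters i).card : ℝ) := by simp

theorem avgRating_eq_zero {i : S} (h : (G.interacted i).card = 0) : G.avgRating i = 0 := by
  have h₁ : G.raters i = ∅ :=
    Finset.subset_empty.1 (Finset.card_eq_zero.1 h ▸ G.raters_subset i)
  simp [avgRating, h₁]

theorem bribedRating_zero (i : S) : G.bribedRating i 0 = G.avgRating i := by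
  by_cases h : (G.interacted i).card = 0
  · simp [bribedRating, h, G.avgRating_eq_zero h]
  · have : ((G.interacted i).card : ℝ) ≠ 0 := Nat.cast_ne_zero.2 h
    simp [bribedRating, this]

theorem bribedRating_nonneg (i : S) {x : ℝ} (hx : 0 ≤ x) : 0 ≤ G.bribedRating i x := by
  have := G.avgRating_nonneg i
  unfold bribedRating
  positivity

theorem bribedRating_mono (i : S) {x y : ℝ} (hx : 0 ≤ x) (hxy : x ≤ y) :
    G.bribedRating i x ≤ G.bribedRating i y := by
  have hb : (0 : ℝ) ≤ ((G.interacted i).card : ℝ) := Nat.cast_nonneg _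
  rcases (add_nonneg hb hx).eq_or_lt with h | h
  · have : G.bribedRating i x = 0 := by rw [bribedRating, ← h, div_zero]
    rw [this]
    exact G.bribedRating_nonneg i (hx.trans hxy)
  · unfold bribedRating
    rw [div_le_div_iff₀ h (by linarith)]
    have := mul_nonneg (mul_nonneg hb (sub_nonneg.2 (G.avgRating_le_one i))) (sub_nonneg.2 hxy)
    linarith

/-- The number of potential buyers left to seller `i` by the other sellers. -/
def availableBuyers (i : S) (φ : S → ℕ) : ℝ :=
  (G.potentialBuyers : ℝ) - ∑ j, (φ j : ℝ) + φ i

theorem availableBuyers_le (i : S) (φ : S → ℕ) :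
    G.availableBuyers i φ ≤ G.potentialBuyers := by
  have := Finset.single_le_sum (f := fun j => (φ j : ℝ)) (fun j _ => Nat.cast_nonneg _)
    (Finset.mem_univ i)
  unfold availableBuyers
  linarith

theorem le_availableBuyers (i : S) {φ : S → ℕ} (h : ∑ j, φ j ≤ G.potentialBuyers) :
    (φ i : ℝ) ≤ G.availableBuyers i φ := by
  have : ∑ j, (φ j : ℝ) ≤ G.potentialBuyers := by exact_mod_cast h
  unfold availableBuyers
  linarith

theorem availableBuyers_le_of_le {φ : S → ℕ} {i : S} (h : G.potentialBuyers ≤ φ i) :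
    G.availableBuyers i φ ≤ φ i :=
  (G.availableBuyers_le i φ).trans (Nat.cast_le.2 h)

theorem coeff_nonneg (i : S) {φ : S → ℕ} (h : 0 ≤ G.availableBuyers i φ) :
    0 ≤ (G.interacted i).card * (1 - G.avgRating i) *
      (G.availableBuyers i φ + (G.interacted i).card) :=
  mul_nonneg (mul_nonneg (Nat.cast_nonneg _) (sub_nonneg.2 (G.avgRating_le_one i)))
    (add_nonneg h (Nat.cast_nonneg _))

/-- The value of `∂u_i / ∂φ_i` for a seller with buyers. -/
noncomputable def marginalUtility (i : S) (φ : S → ℕ) (y : ℝ) : ℝ :=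
  G.profit * ((G.interacted i).card * (1 - G.avgRating i) *
    (G.availableBuyers i φ + (G.interacted i).card) / ((G.interacted i).card + y) ^ 2 - 1)

theorem continuousOn_marginalUtility (i : S) (φ : S → ℕ)
    (h : 0 < ((G.interacted i).card : ℝ)) :
    ContinuousOn (G.marginalUtility i φ) (Set.Ici 0) := by
  unfold marginalUtility
  refine continuousOn_const.mul (ContinuousOn.sub (ContinuousOn.div continuousOn_const
    (by fun_prop) ?_) continuousOn_const)
  intro y hy
  have : (0 : ℝ) ≤ y := hy
  positivity

/-- The bribed buyer number `n + 1` of seller `i` is profitable if and only if, before this bribe,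
at least `bribeThreshold i n` potential buyers are left. -/
noncomputable def bribeThreshold (i : S) (n : ℕ) : ℝ :=
  if G.profit * (G.bribedRating i (n + 1) - G.bribedRating i n) = 0 then G.potentialBuyers + 1
  else (1 + G.profit * G.bribedRating i (n + 1)) /
    (G.profit * (G.bribedRating i (n + 1) - G.bribedRating i n))

theorem bribe_gain_nonneg (i : S) (n : ℕ) :
    0 ≤ G.profit * (G.bribedRating i (n + 1) - G.bribedRating i n) :=
  mul_nonneg G.profit_nonneg (sub_nonneg.2
    (G.bribedRating_mono i (Nat.cast_nonneg n) (le_add_of_nonneg_right zero_le_one)))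

theorem bribe_loss_pos (i : S) (n : ℕ) : 0 < 1 + G.profit * G.bribedRating i (n + 1) := by
  have := mul_nonneg G.profit_nonneg (G.bribedRating_nonneg i (x := (n : ℝ) + 1) (by positivity))
  linarith

theorem bribeThreshold_pos (i : S) (n : ℕ) : 0 < G.bribeThreshold i n := by
  unfold bribeThreshold
  split_ifs with h
  · positivity
  · exact div_pos (G.bribe_loss_pos i n) ((G.bribe_gain_nonneg i n).lt_of_ne' h)

section Deviation

variable [DecidableEq S]

theorem sum_update_toReal (i : S) (φ : S → ℕ) (y : ℝ) :
    ∑ j, Function.update (toReal φ) i y j = ∑ j, (φ j : ℝ) - φ i + y := by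
  rw [Finset.sum_update_of_mem (Finset.mem_univ i),
    ← Finset.add_sum_erase _ _ (Finset.mem_univ i), Finset.sdiff_singleton_eq_erase]
  simp only [toReal]
  ring

theorem utility_update (i : S) (φ : S → ℕ) (y : ℝ) :
    G.utility i (Function.update (toReal φ) i y) =
      (G.availableBuyers i φ - y) * G.bribedRating i y * G.profit := by
  rw [utility, sum_update_toReal, Function.update_self, expectedUtility, availableBuyers]
  ring

theorem update_toReal_self {S : Type*} [DecidableEq S] (i : S) (φ : S → ℕ) :
    Function.update (toReal φ) i (φ i : ℝ) = toReal φ :=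
  Function.update_eq_self i _

theorem utility_toReal (i : S) (φ : S → ℕ) :
    G.utility i (toReal φ) =
      (G.availableBuyers i φ - φ i) * G.bribedRating i (φ i) * G.profit := by
  rw [← utility_update, update_toReal_self]

/-- For a seller with buyers, the utility is affine minus a multiple of `1 / (|B_i| + y)`. -/
theorem utility_update_eq (i : S) (φ : S → ℕ) {y : ℝ} (h : ((G.interacted i).card : ℝ) + y ≠ 0) :
    G.utility i (Function.update (toReal φ) i y) =
      G.profit * (G.availableBuyers i φ + (G.interacted i).card * (1 - G.avgRating i) - y -
        (G.interacted i).card * (1 - G.avgRating i) *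
          (G.availableBuyers i φ + (G.interacted i).card) / ((G.interacted i).card + y)) := by
  rw [utility_update, bribedRating]
  field_simp
  ring

theorem hasMarginalUtility (i : S) (φ : S → ℕ) {y : ℝ}
    (h : 0 < ((G.interacted i).card : ℝ) + y) :
    G.HasMarginalUtility i φ y (G.marginalUtility i φ y) := by
  set b : ℝ := ((G.interacted i).card : ℝ) with hb
  set c : ℝ := b * (1 - G.avgRating i) * (G.availableBuyers i φ + b) with hc
  have h₁ : HasDerivAt (fun z : ℝ => b + z) 1 y := (hasDerivAt_id y).const_add b
  have h₂ : HasDerivAt (fun z : ℝ => G.profit *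
      (G.availableBuyers i φ + b * (1 - G.avgRating i) - z - c / (b + z)))
      (G.profit * ((0 - 1) - (0 * (b + y) - c * 1) / (b + y) ^ 2)) y :=
    ((((hasDerivAt_const y _).sub (hasDerivAt_id y))).sub
      ((hasDerivAt_const y c).div h₁ h.ne')).const_mul _
  have h₃ : G.marginalUtility i φ y =
      G.profit * ((0 - 1) - (0 * (b + y) - c * 1) / (b + y) ^ 2) := by
    rw [marginalUtility, ← hb, ← hc]
    ring
  rw [HasMarginalUtility, h₃]
  refine h₂.congr_of_eventuallyEq ?_
  filter_upwards [h₁.continuousAt.eventually_ne h.ne'] with z hz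
  exact G.utility_update_eq i φ hz

/-- The change of payoff of seller `i` caused by the bribed buyer number `n + 1`. -/
noncomputable def payoffIncrement (i : S) (φ : S → ℕ) (n : ℕ) : ℝ :=
  G.payoff i (Function.update (toReal φ) i ((n + 1 : ℕ) : ℝ)) -
    G.payoff i (Function.update (toReal φ) i (n : ℝ))

theorem payoffIncrement_eq_utility (i : S) (φ : S → ℕ) (n : ℕ) :
    G.payoffIncrement i φ n = G.utility i (Function.update (toReal φ) i ((n : ℝ) + 1)) -
      G.utility i (Function.update (toReal φ) i (n : ℝ)) - 1 := by
  simp only [payoffIncrement, payoff, Function.update_self]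
  push_cast
  ring

theorem payoffIncrement_eq (i : S) (φ : S → ℕ) (n : ℕ) :
    G.payoffIncrement i φ n = G.profit * (G.bribedRating i (n + 1) - G.bribedRating i n) *
      (G.availableBuyers i φ - n) - (1 + G.profit * G.bribedRating i (n + 1)) := by
  rw [payoffIncrement_eq_utility, utility_update, utility_update]
  ring

theorem payoffIncrement_eq_of_pos (i : S) (φ : S → ℕ) (n : ℕ)
    (h : 0 < ((G.interacted i).card : ℝ)) :
    G.payoffIncrement i φ n = G.profit * ((G.interacted i).card * (1 - G.avgRating i) *
      (G.availableBuyers i φ + (G.interacted i).card) /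
        (((G.interacted i).card + n) * ((G.interacted i).card + (n + 1))) - 1) - 1 := by
  have h₁ : 0 < ((G.interacted i).card : ℝ) + n := by positivity
  have h₂ : 0 < ((G.interacted i).card : ℝ) + (n + 1) := by positivity
  rw [payoffIncrement_eq_utility, utility_update_eq _ _ _ h₁.ne', utility_update_eq _ _ _ h₂.ne']
  field_simp
  ring

/-- The payoff of a seller is discretely concave in its own strategy. -/
theorem antitone_payoffIncrement (i : S) {φ : S → ℕ} (h : 0 ≤ G.availableBuyers i φ) :
    Antitone (G.payoffIncrement i φ) := by
  have hk := G.profit_nonneg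
  refine antitone_nat_of_succ_le fun n => ?_
  rcases Nat.eq_zero_or_pos (G.interacted i).card with hb | hb
  · have h₁ : ∀ m : ℕ, G.bribedRating i ((m : ℝ) + 1) = 1 := fun m => by
      have : (m : ℝ) + 1 ≠ 0 := by positivity
      simp [bribedRating, hb, this]
    rw [payoffIncrement_eq, payoffIncrement_eq, h₁, h₁]
    cases n with
    | zero =>
      have h₂ : G.bribedRating i ((0 : ℕ) : ℝ) = 0 := by
        rw [Nat.cast_zero, bribedRating_zero, G.avgRating_eq_zero hb]
      have h₃ := h₁ 0
      simp only [zero_add, Nat.cast_zero, Nat.cast_one] at h₂ h₃ ⊢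
      rw [h₂, h₃]
      have := mul_nonneg hk h
      linarith
    | succ n =>
      have h₂ := h₁ n
      have h₃ := h₁ (n + 1)
      push_cast at h₂ h₃ ⊢
      rw [h₂, h₃]
      linarith
  · have hb' : 0 < ((G.interacted i).card : ℝ) := Nat.cast_pos.2 hb
    rw [payoffIncrement_eq_of_pos _ _ _ _ hb', payoffIncrement_eq_of_pos _ _ _ _ hb']
    have := G.coeff_nonneg i h
    gcongr <;> simp

theorem integerFirstOrderCondition_iff (i : S) (φ : S → ℕ) :
    G.IntegerFirstOrderCondition i φ ↔
      G.payoffIncrement i φ (φ i) ≤ 0 ∧ ∀ n, φ i = n + 1 → 0 ≤ G.payoffIncrement i φ n := by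
  unfold IntegerFirstOrderCondition
  rw [payoffIncrement_eq_utility, update_toReal_self]
  refine and_congr (by rw [sub_nonpos]) ?_
  have key : ∀ n, φ i = n + 1 → (0 ≤ G.payoffIncrement i φ n ↔ 1 ≤ G.utility i (toReal φ) -
      G.utility i (Function.update (toReal φ) i ((φ i : ℝ) - 1))) := by
    intro n hn
    have h : (φ i : ℝ) = (n : ℝ) + 1 := by rw [hn]; push_cast; rfl
    rw [payoffIncrement_eq_utility, ← h, update_toReal_self, h, add_sub_cancel_right, sub_nonneg]
  constructor
  · intro h n hn
    exact (key n hn).2 (h (by omega))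
  · intro h hpos
    exact (key (φ i - 1) (by omega)).1 (h _ (by omega))

theorem payoff_le_of_increments (i : S) {φ : S → ℕ} (h : 0 ≤ G.availableBuyers i φ)
    (hfoc : G.IntegerFirstOrderCondition i φ) (n : ℕ) :
    G.payoff i (Function.update (toReal φ) i (n : ℝ)) ≤ G.payoff i (toReal φ) := by
  obtain ⟨hup, hdown⟩ := (G.integerFirstOrderCondition_iff i φ).1 hfoc
  have hanti := G.antitone_payoffIncrement i h
  set v : ℕ → ℝ := fun n => G.payoff i (Function.update (toReal φ) i (n : ℝ)) with hv
  have hself : v (φ i) = G.payoff i (toReal φ) := by rw [hv]; simp only [update_toReal_self]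
  have hinc : ∀ m, v (m + 1) - v m = G.payoffIncrement i φ m := fun m => rfl
  rw [← hself]
  change v n ≤ v (φ i)
  rcases le_total (φ i) n with hn | hn
  · induction n, hn using Nat.le_induction with
    | base => exact le_rfl
    | succ m hm ih => linarith [hinc m, hanti hm]
  · induction hn using Nat.decreasingInduction with
    | self => exact le_rfl
    | of_succ m hm ih =>
      have := hdown (φ i - 1) (by omega)
      linarith [hinc m, hanti (show m ≤ φ i - 1 by omega)]

theorem isNashEquilibrium_of_integerFirstOrderCondition {φ : S → ℕ}
    (hsum : ∑ i, φ i ≤ G.potentialBuyers) (hfoc : ∀ i, G.IntegerFirstOrderCondition i φ) :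
    G.IsNashEquilibrium φ := by
  refine ⟨fun i => ?_, fun i x _ => ?_⟩
  · exact Finset.mem_range_succ_iff.2
      ((Finset.single_le_sum (fun j _ => Nat.zero_le (φ j)) (Finset.mem_univ i)).trans hsum)
  · exact G.payoff_le_of_increments i
      ((Nat.cast_nonneg _).trans (G.le_availableBuyers i hsum)) (hfoc i) x

theorem IsNashEquilibrium.utility_sub_le {G : RatingSystem S B} {φ : S → ℕ}
    (h : G.IsNashEquilibrium φ) (i : S) {n : ℕ} (hn : n ≤ G.potentialBuyers) :
    G.utility i (Function.update (toReal φ) i (n : ℝ)) - n ≤ G.utility i (toReal φ) - φ i := by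
  have := h.2 i n (Finset.mem_range_succ_iff.2 hn)
  simp only [payoff, Function.update_self] at this
  change _ ≤ _ - _ - (φ i : ℝ) at this
  linarith

theorem IsNashEquilibrium.sum_le {G : RatingSystem S B} {φ : S → ℕ}
    (h : G.IsNashEquilibrium φ) : ∑ i, φ i ≤ G.potentialBuyers := by
  by_contra! hlt
  obtain ⟨i, -, hi⟩ : ∃ i ∈ Finset.univ, φ i ≠ 0 :=
    Finset.exists_ne_zero_of_sum_ne_zero (by omega)
  have hpos : (0 : ℝ) < φ i := Nat.cast_pos.2 (Nat.pos_of_ne_zero hi)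
  have hneg : G.availableBuyers i φ - φ i ≤ 0 := by
    have : (G.potentialBuyers : ℝ) < ∑ i, (φ i : ℝ) := by exact_mod_cast hlt
    unfold availableBuyers
    linarith
  have h₀ := h.utility_sub_le i (Nat.zero_le _)
  rw [utility_update, utility_toReal, Nat.cast_zero] at h₀
  have h₁ : (G.availableBuyers i φ - φ i) * G.bribedRating i (φ i) ≤
      (G.availableBuyers i φ - φ i) * G.bribedRating i 0 :=
    mul_le_mul_of_nonpos_left (G.bribedRating_mono i le_rfl hpos.le) hneg
  have h₂ : (G.availableBuyers i φ - φ i) * G.bribedRating i 0 ≤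
      (G.availableBuyers i φ - 0) * G.bribedRating i 0 :=
    mul_le_mul_of_nonneg_right (by linarith) (G.bribedRating_nonneg i le_rfl)
  have h₃ := mul_le_mul_of_nonneg_right (h₁.trans h₂) G.profit_nonneg
  linarith

/-- A saturated seller loses by bribing. -/
theorem IsSaturated.utility_lt {G : RatingSystem S B} {i : S} (h : G.IsSaturated i)
    (φ : S → ℕ) {n : ℕ} (hn : 0 < n) :
    G.utility i (Function.update (toReal φ) i (n : ℝ)) <
      G.utility i (Function.update (toReal φ) i 0) + n := by
  have hn' : (0 : ℝ) < n := Nat.cast_pos.2 hn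
  have hb : (0 : ℝ) ≤ ((G.interacted i).card : ℝ) := Nat.cast_nonneg _
  have hk := G.profit_nonneg
  have hr := G.avgRating_nonneg i
  have hden : 0 < ((G.interacted i).card : ℝ) + n := by positivity
  rw [utility_update, utility_update, bribedRating_zero, ← sub_lt_iff_lt_add', bribedRating]
  have heq : (G.availableBuyers i φ - n) *
      ((G.avgRating i * (G.interacted i).card + n) / ((G.interacted i).card + n)) * G.profit -
      (G.availableBuyers i φ - 0) * G.avgRating i * G.profit =
      n * ((G.profit * G.availableBuyers i φ * (1 - G.avgRating i) -
        G.profit * G.avgRating i * (G.interacted i).card - G.profit * n) /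
          ((G.interacted i).card + n)) := by
    field_simp
    ring
  rw [heq]
  refine mul_lt_of_lt_one_right hn' ((div_lt_one hden).2 ?_)
  have h₁ : G.profit * G.availableBuyers i φ * (1 - G.avgRating i) ≤ (G.interacted i).card := by
    calc _ ≤ G.profit * G.potentialBuyers * (1 - G.avgRating i) :=
          mul_le_mul_of_nonneg_right (mul_le_mul_of_nonneg_left (G.availableBuyers_le i φ) hk)
            (sub_nonneg.2 (G.avgRating_le_one i))
      _ ≤ G.profit * G.potentialBuyers * 1 :=
          mul_le_mul_of_nonneg_left (by linarith) (by positivity)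
      _ ≤ _ := by rw [mul_one]; exact h
  have h₂ : 0 ≤ G.profit * G.avgRating i * (G.interacted i).card := by positivity
  have h₃ : 0 ≤ G.profit * (n : ℝ) := by positivity
  linarith

theorem IsNashEquilibrium.satisfiesConstraints {G : RatingSystem S B} {φ : S → ℕ}
    (h : G.IsNashEquilibrium φ) : G.SatisfiesConstraints φ := by
  refine ⟨h.sum_le, fun i hi => ?_⟩
  by_contra hne
  have h₁ := hi.utility_lt φ (Nat.pos_of_ne_zero hne)
  have h₂ := h.utility_sub_le i (Nat.zero_le _)
  rw [update_toReal_self] at h₁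
  rw [Nat.cast_zero] at h₂
  linarith

/-- Once no potential buyer is left, another bribe does not pay. -/
theorem payoffIncrement_nonpos (i : S) {φ : S → ℕ}
    (h : G.availableBuyers i φ ≤ φ i) : G.payoffIncrement i φ (φ i) ≤ 0 := by
  rw [payoffIncrement_eq]
  have h₁ := G.bribedRating_mono i (Nat.cast_nonneg (φ i)) (le_add_of_nonneg_right zero_le_one)
  have h₂ : 0 ≤ G.profit * G.bribedRating i ((φ i : ℝ) + 1) :=
    mul_nonneg G.profit_nonneg (G.bribedRating_nonneg i (by positivity))
  have h₃ := mul_nonpos_of_nonneg_of_nonpos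
    (mul_nonneg G.profit_nonneg (sub_nonneg.2 h₁)) (sub_nonpos.2 h)
  linarith

theorem IsNashEquilibrium.integerFirstOrderCondition {G : RatingSystem S B} {φ : S → ℕ}
    (h : G.IsNashEquilibrium φ) (i : S) : G.IntegerFirstOrderCondition i φ := by
  rw [integerFirstOrderCondition_iff]
  have hi := Finset.mem_range_succ_iff.1 (h.1 i)
  constructor
  · rcases hi.eq_or_lt with heq | hlt
    · exact G.payoffIncrement_nonpos i (G.availableBuyers_le_of_le heq.ge)
    · rw [payoffIncrement, update_toReal_self]
      exact sub_nonpos.2 (h.2 i _ (Finset.mem_range_succ_iff.2 hlt))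
  · intro n hn
    rw [payoffIncrement, ← hn, update_toReal_self]
    exact sub_nonneg.2 (h.2 i _ (Finset.mem_range_succ_iff.2 (by omega)))

theorem isNashEquilibrium_iff (φ : S → ℕ) : G.IsNashEquilibrium φ ↔
    G.SatisfiesConstraints φ ∧ ∀ i, G.IntegerFirstOrderCondition i φ :=
  ⟨fun h => ⟨h.satisfiesConstraints, h.integerFirstOrderCondition⟩,
    fun h => G.isNashEquilibrium_of_integerFirstOrderCondition h.1.1 h.2⟩

theorem payoffIncrement_nonpos_of_le {i : S} {φ : S → ℕ} {n : ℕ}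
    (h : G.availableBuyers i φ - n ≤ G.bribeThreshold i n) : G.payoffIncrement i φ n ≤ 0 := by
  have h₁ := G.bribe_loss_pos i n
  rw [payoffIncrement_eq]
  unfold bribeThreshold at h
  split_ifs at h with h₀
  · rw [h₀]
    linarith
  · rw [le_div_iff₀ ((G.bribe_gain_nonneg i n).lt_of_ne' h₀)] at h
    linarith

theorem payoffIncrement_nonneg_of_le {i : S} {φ : S → ℕ} {n : ℕ}
    (h : G.bribeThreshold i n ≤ G.availableBuyers i φ - n) : 0 ≤ G.payoffIncrement i φ n := by
  rw [payoffIncrement_eq]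
  unfold bribeThreshold at h
  split_ifs at h with h₀
  · linarith [G.availableBuyers_le i φ, (Nat.cast_nonneg n : (0 : ℝ) ≤ n)]
  · rw [div_le_iff₀ ((G.bribe_gain_nonneg i n).lt_of_ne' h₀)] at h
    linarith

/-- A function on profiles whose coordinatewise local minima solve the integer first-order
conditions. -/
noncomputable def potential (φ : S → ℕ) : ℝ :=
  ∑ i, ∑ n ∈ Finset.range (φ i), G.bribeThreshold i n -
    ∑ m ∈ Finset.range (∑ i, φ i), ((G.potentialBuyers : ℝ) - m)

theorem potential_update_succ (φ : S → ℕ) (i : S) :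
    G.potential (Function.update φ i (φ i + 1)) - G.potential φ =
      G.bribeThreshold i (φ i) - (G.potentialBuyers - ∑ j, (φ j : ℝ)) := by
  have h₁ : ∑ j, Function.update φ i (φ i + 1) j = ∑ j, φ j + 1 := by
    rw [Finset.sum_update_of_mem (Finset.mem_univ i),
      ← Finset.add_sum_erase _ φ (Finset.mem_univ i), Finset.sdiff_singleton_eq_erase]
    ring
  have h₂ : ∑ j, ∑ n ∈ Finset.range (Function.update φ i (φ i + 1) j), G.bribeThreshold j n =
      ∑ j, ∑ n ∈ Finset.range (φ j), G.bribeThreshold j n + G.bribeThreshold i (φ i) := by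
    rw [← Finset.add_sum_erase _ _ (Finset.mem_univ i),
      ← Finset.add_sum_erase _ (fun j => ∑ n ∈ Finset.range (φ j), G.bribeThreshold j n)
        (Finset.mem_univ i), Function.update_self, Finset.sum_range_succ,
      add_right_comm]
    refine congrArg (_ + · + _) (Finset.sum_congr rfl fun j hj => ?_)
    rw [Function.update_of_ne (Finset.ne_of_mem_erase hj)]
  rw [potential, potential, h₁, h₂, Finset.sum_range_succ]
  push_cast
  ring

theorem exists_isNashEquilibrium : ∃ φ : S → ℕ, G.IsNashEquilibrium φ := by
  obtain ⟨φ, hφ, hmin⟩ := (Fintype.piFinset fun _ : S => G.strategySpace).exists_min_image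
    G.potential ⟨fun _ => 0, by simp [strategySpace]⟩
  have hmem : ∀ i, φ i ≤ G.potentialBuyers := fun i =>
    Finset.mem_range_succ_iff.1 (Fintype.mem_piFinset.1 hφ i)
  have hupd : ∀ i n, n ≤ G.potentialBuyers → G.potential φ ≤ G.potential (Function.update φ i n) :=
    fun i n hn => hmin _ <| Fintype.mem_piFinset.2 fun j => by
      rcases eq_or_ne j i with rfl | hj
      · rw [Function.update_self]
        exact Finset.mem_range_succ_iff.2 hn
      · rw [Function.update_of_ne hj]
        exact Finset.mem_range_succ_iff.2 (hmem j)
  have hdown : ∀ i n, φ i = n + 1 →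
      G.bribeThreshold i n ≤ G.potentialBuyers - ∑ j, (φ j : ℝ) + 1 := by
    intro i n hn
    have h₁ := G.potential_update_succ (Function.update φ i n) i
    rw [Function.update_self, Function.update_idem, ← hn, Function.update_eq_self] at h₁
    have h₂ := hupd i n (by have := hmem i; omega)
    have h₃ : ∑ j, (Function.update φ i n j : ℝ) = ∑ j, (φ j : ℝ) - 1 := by
      have := sum_update_toReal i φ n
      rw [hn] at this
      push_cast at this
      rw [show ∑ j, (φ j : ℝ) - 1 = ∑ j, (φ j : ℝ) - ((n : ℝ) + 1) + n by ring, ← this]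
      refine Finset.sum_congr rfl fun j _ => ?_
      rcases eq_or_ne j i with rfl | hj
      · simp
      · simp [hj, toReal]
    rw [h₃] at h₁
    linarith
  refine ⟨φ, G.isNashEquilibrium_of_integerFirstOrderCondition ?_ fun i => ?_⟩
  · by_contra! hlt
    obtain ⟨i, -, hi⟩ : ∃ i ∈ Finset.univ, φ i ≠ 0 :=
      Finset.exists_ne_zero_of_sum_ne_zero (by omega)
    have h₁ := hdown i (φ i - 1) (by omega)
    have h₂ := G.bribeThreshold_pos i (φ i - 1)
    have h₃ : (G.potentialBuyers : ℝ) + 1 ≤ ∑ i, (φ i : ℝ) := by exact_mod_cast hlt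
    linarith
  · rw [integerFirstOrderCondition_iff]
    constructor
    · rcases (hmem i).eq_or_lt with heq | hlt
      · exact G.payoffIncrement_nonpos i (G.availableBuyers_le_of_le heq.ge)
      · refine G.payoffIncrement_nonpos_of_le ?_
        have h₁ := G.potential_update_succ φ i
        have h₂ := hupd i (φ i + 1) hlt
        unfold availableBuyers
        linarith
    · intro n hn
      refine G.payoffIncrement_nonneg_of_le ?_
      have h₁ := hdown i n hn
      rw [availableBuyers, hn]
      push_cast
      linarith

/-- By the mean value theorem, an increment of the utility is a marginal utility in between. -/
theorem exists_marginalUtility_eq (i : S) (φ : S → ℕ) (n : ℕ)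
    (hb : 0 < ((G.interacted i).card : ℝ)) :
    ∃ y ∈ Set.Ioo (n : ℝ) (n + 1), G.marginalUtility i φ y = G.payoffIncrement i φ n + 1 := by
  have hder : ∀ y : ℝ, 0 ≤ y → G.HasMarginalUtility i φ y (G.marginalUtility i φ y) :=
    fun y hy => G.hasMarginalUtility i φ (by positivity)
  have hn : (0 : ℝ) ≤ n := Nat.cast_nonneg n
  obtain ⟨y, hy, h⟩ := exists_hasDerivAt_eq_slope
    (fun y : ℝ => G.utility i (Function.update (toReal φ) i y)) (G.marginalUtility i φ)
    (lt_add_one (n : ℝ))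
    (fun y hy => (hder y (hn.trans hy.1)).continuousAt.continuousWithinAt)
    (fun y hy => hder y (hn.trans hy.1.le))
  refine ⟨y, hy, ?_⟩
  rw [h, payoffIncrement_eq_utility]
  ring

theorem exists_hasMarginalUtility_one (i : S) (φ : S → ℕ) {a c : ℝ}
    (hb : 0 < ((G.interacted i).card : ℝ)) (ha : 0 ≤ a) (hac : a ≤ c)
    (h₁ : 1 ≤ G.marginalUtility i φ a) (h₂ : G.marginalUtility i φ c ≤ 1) :
    ∃ x ∈ Set.Icc a c, G.HasMarginalUtility i φ x 1 := by
  obtain ⟨x, hx, h⟩ := intermediate_value_Icc' hac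
    ((G.continuousOn_marginalUtility i φ hb).mono fun y hy => ha.trans hy.1) ⟨h₂, h₁⟩
  have : 0 ≤ x := ha.trans hx.1
  exact ⟨x, hx, h ▸ G.hasMarginalUtility i φ (by positivity)⟩

theorem IntegerFirstOrderCondition.exists_hasMarginalUtility {G : RatingSystem S B} {i : S}
    {φ : S → ℕ} (h : G.IntegerFirstOrderCondition i φ) (hB : (G.interacted i).Nonempty) :
    (∃ x : ℝ, 0 ≤ x ∧ |x - (φ i : ℝ)| < 1 ∧ G.HasMarginalUtility i φ x 1) ∨
      (φ i = 0 ∧ ∃ d : ℝ, d ≤ 1 ∧ G.HasMarginalUtility i φ 0 d) := by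
  have hb : 0 < ((G.interacted i).card : ℝ) := Nat.cast_pos.2 hB.card_pos
  obtain ⟨hup, hdown⟩ := (G.integerFirstOrderCondition_iff i φ).1 h
  obtain ⟨c, hc, hc'⟩ := G.exists_marginalUtility_eq i φ (φ i) hb
  have hc₁ : G.marginalUtility i φ c ≤ 1 := by linarith
  obtain hn | ⟨n, hn⟩ : φ i = 0 ∨ ∃ n, φ i = n + 1 := by
    cases φ i <;> simp
  · rw [hn, Nat.cast_zero, zero_add] at hc
    rcases le_total (G.marginalUtility i φ 0) 1 with h₀ | h₀
    · exact .inr ⟨hn, _, h₀, G.hasMarginalUtility i φ (by linarith)⟩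
    · obtain ⟨x, hx, h₁⟩ := G.exists_hasMarginalUtility_one i φ hb le_rfl hc.1.le h₀ hc₁
      refine .inl ⟨x, hx.1, ?_, h₁⟩
      rw [hn, Nat.cast_zero, abs_lt]
      constructor <;> linarith [hx.1, hx.2, hc.2]
  · obtain ⟨a, ha, ha'⟩ := G.exists_marginalUtility_eq i φ n hb
    have hn' : (φ i : ℝ) = n + 1 := by rw [hn]; push_cast; rfl
    have ha₀ : 0 ≤ a := (Nat.cast_nonneg n).trans ha.1.le
    obtain ⟨x, hx, h₁⟩ := G.exists_hasMarginalUtility_one i φ hb ha₀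
      (by linarith [ha.2, hc.1]) (by linarith [hdown n hn]) hc₁
    refine .inl ⟨x, ha₀.trans hx.1, ?_, h₁⟩
    rw [abs_lt]
    constructor <;> linarith [hx.1, hx.2, ha.1, hc.2]

/-- A seller without buyers never has marginal utility `1`. -/
theorem not_hasMarginalUtility_one {i : S} {φ : S → ℕ} (hb : (G.interacted i).card = 0)
    (hA : 0 ≤ G.availableBuyers i φ) : ¬ G.HasMarginalUtility i φ (φ i) 1 := by
  intro h
  have hk := G.profit_nonneg
  have hu : ∀ y : ℝ, y ≠ 0 → G.utility i (Function.update (toReal φ) i y) =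
      (G.availableBuyers i φ - y) * G.profit := fun y hy => by
    simp [utility_update, bribedRating, hb, hy]
  rcases Nat.eq_zero_or_pos (φ i) with h₀ | h₀
  · rw [h₀, Nat.cast_zero] at h
    have h₁ := (hasDerivAt_iff_tendsto_slope_left_right.1 h).1
    refine absurd (le_of_tendsto h₁ ?_) (not_le.2 zero_lt_one)
    filter_upwards [self_mem_nhdsWithin] with y (hy : y < 0)
    have h₂ : G.utility i (Function.update (toReal φ) i 0) = 0 := by
      rw [utility_update, bribedRating_zero, G.avgRating_eq_zero hb]
      ring
    rw [slope_def_field, hu y hy.ne, h₂]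
    exact div_nonpos_of_nonneg_of_nonpos
      (by rw [sub_zero]; exact mul_nonneg (by linarith) hk) (by linarith)
  · have hpos : (0 : ℝ) < φ i := Nat.cast_pos.2 h₀
    have h₁ : HasDerivAt (fun y : ℝ => (G.availableBuyers i φ - y) * G.profit)
        (-1 * G.profit) (φ i) := ((hasDerivAt_id _).const_sub _).mul_const _
    have h₂ := h₁.congr_of_eventuallyEq
      ((eventually_ne_nhds hpos.ne').mono fun y hy => hu y hy)
    linarith [h.unique h₂]

theorem IsSaturated.integerFirstOrderCondition {G : RatingSystem S B} {i : S}
    (h : G.IsSaturated i) {φ : S → ℕ} (h₀ : φ i = 0) : G.IntegerFirstOrderCondition i φ := by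
  refine ⟨?_, fun hpos => absurd h₀ hpos.ne'⟩
  have h₁ := h.utility_lt φ one_pos
  have h₂ := update_toReal_self i φ
  rw [h₀, Nat.cast_zero] at h₂
  rw [h₂, Nat.cast_one] at h₁
  rw [h₀, Nat.cast_zero, zero_add]
  linarith

theorem HasMarginalUtility.integerFirstOrderCondition {G : RatingSystem S B} {i : S} {φ : S → ℕ}
    (h : G.HasMarginalUtility i φ (φ i) 1) (hA : 0 ≤ G.availableBuyers i φ) :
    G.IntegerFirstOrderCondition i φ := by
  have hk := G.profit_nonneg
  have hb : 0 < ((G.interacted i).card : ℝ) :=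
    Nat.cast_pos.2 (Nat.pos_of_ne_zero fun hb => G.not_hasMarginalUtility_one hb hA h)
  have hc := G.coeff_nonneg i hA
  have h₁ : G.marginalUtility i φ (φ i) = 1 :=
    (G.hasMarginalUtility i φ (by positivity)).unique h
  rw [integerFirstOrderCondition_iff]
  constructor
  · rw [payoffIncrement_eq_of_pos _ _ _ _ hb, sub_nonpos]
    refine le_trans ?_ h₁.le
    rw [marginalUtility, sq]
    gcongr
    linarith
  · intro n hn
    have hn' : (φ i : ℝ) = n + 1 := by rw [hn]; push_cast; rfl
    rw [payoffIncrement_eq_of_pos _ _ _ _ hb, sub_nonneg]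
    refine h₁.ge.trans ?_
    rw [marginalUtility, sq, hn']
    gcongr
    linarith

end Deviation

end RatingSystem

theorem mainTheorem1 {S B : Type*} [Fintype S] [DecidableEq S] [Fintype B]
    (G : RatingSystem S B) :
    -- The bribery game has a Nash equilibrium.
    (∃ φ : S → ℕ, G.IsNashEquilibrium φ) ∧
    -- The equilibria are the solutions of the integer first-order conditions under the constraints.
    (∀ φ : S → ℕ, G.IsNashEquilibrium φ ↔
      G.SatisfiesConstraints φ ∧ ∀ i, G.IntegerFirstOrderCondition i φ) ∧
    -- Up to rounding, an equilibrium solves `∂u_i / ∂φ_i = 1`, or is at the corner `φ_i = 0`.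
    (∀ φ : S → ℕ, G.IsNashEquilibrium φ → ∀ i, (G.interacted i).Nonempty →
      (∃ x : ℝ, 0 ≤ x ∧ |x - (φ i : ℝ)| < 1 ∧ G.HasMarginalUtility i φ x 1) ∨
      (φ i = 0 ∧ ∃ d : ℝ, d ≤ 1 ∧ G.HasMarginalUtility i φ 0 d)) ∧
    -- Exact solutions of `∂u_i / ∂φ_i = 1` under the constraints are equilibria.
    (∀ φ : S → ℕ, G.SatisfiesConstraints φ →
      (∀ i, G.IsSaturated i ∨ G.HasMarginalUtility i φ (φ i : ℝ) 1) →
      G.IsNashEquilibrium φ) := by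
  refine ⟨G.exists_isNashEquilibrium, G.isNashEquilibrium_iff,
    fun φ h i hB => (h.integerFirstOrderCondition i).exists_hasMarginalUtility hB,
    fun φ hC h => (G.isNashEquilibrium_iff φ).2 ⟨hC, fun i => ?_⟩⟩
  rcases h i with hs | hm
  · exact hs.integerFirstOrderCondition (hC.2 i hs)
  · exact hm.integerFirstOrderCondition
      ((Nat.cast_nonneg _).trans (G.le_availableBuyers i hC.1))
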